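/- For $\lambda>0$ let $C_k^{\lambda}$ be the Gegenbauer polynomials, $\sum_{k\ge 0} C_k^\lambda(x)z^k=(1-2xz+z^2)^{-\lambda}$. The two-point (Delsarte linear programming) bound for spherical codes in $S^{n-1}$ with minimal angle $\theta$ is the infimum of $f(1)/f_0$ over all real polynomials $f=\sum_{k=0}^d f_kC_k^{n/2-1}$ with $f_0>0$, all $f_k\ge 0$, and $f(x)\le 0$ for $-1\le x\le\cos\theta$. It is sharp for a code with minimal angle $\theta$ if it equals the number of points of the code. For the parameters $(n,N,\cos\theta)$ of the Nordstrom-Robinson spherical code, the codes from the Gewirtz, Hoffman-Singleton and $M_{22}$ graphs, and the Kerdock spherical codes in dimensions $64$, $256$, $1024$, the two-point bound has exactly the following value $B$: | $n$ | $N$ | $\cos\theta$ | $B$ | |---|---|---|---| | $16$ | $288$ | $1/4$ | $312$ | | $20$ | $56$ | $1/15$ | $31416/451=69.6585\ldots$ | | $21$ | $50$ | $1/21$ | $64$ | | $21$ | $77$ | $1/12$ | $74382/861=86.3902\ldots$ | | $64$ | $4224$ | $1/8$ | $4448$ | | $256$ | $66048$ | $1/16$ | $67968$ | | $1024$ | $1050624$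 | $1/32$ | $1066496$ | In every case $B>N$; hence the two-point bound is not sharp for any spherical code of $N$ points in $S^{n-1}$ with minimal angle $\theta$, in particular for the codes named above. Moreover, for each case let $t_1,\dots,t_m$ and $w_1,\dots,w_m$ be as follows (the two signs $\pm$ correspond, and the lower sign comes first): | $n$, $N$ | $t_1,\dots,t_m$ | $w_1,\dots,w_m$ | |---|---|---| | $16$, $288$ | $-\frac12\pm\frac{\sqrt3}{6},\ \frac14,\ 1$ | $\frac{3825}{46}\pm\frac{2115}{46}\sqrt3,\ \frac{3328}{23},\ 1$ | | $20$, $56$ | $-\frac{16}{35},\ \frac1{15},\ 1$ | $\frac{4802}{451},\ \frac{26163}{451},\ 1$ | | $21$, $50$ | $-\frac{11}{21},\ \frac1{21},\ 1$ | $7,\ 56,\ 1$ | | $21$, $77$ | $-\frac{13}{33},\ \frac1{12},\ 1$ | $\frac{14641}{861},\ \frac{58880}{861},\ 1$ | | $64$, $4224$ | $-\frac12\pm\frac{\sqrt{627}}{66},\ \frac18,\ 1$ | $\frac{1178199}{1042}\pm\frac{892485}{19798}\sqrt{627},\ \frac{1138688}{521},\ 1$ | | $256$, $66048$ | $-\frac12\pm\frac{\sqrt{1419}}{86},\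 \frac1{16},\ 1$ | $\frac{15594423}{914}\pm\frac{4553399}{10054}\sqrt{1419},\ \frac{15466496}{457},\ 1$ | | $1024$, $1050624$ | $-\frac12\pm\frac{\sqrt{231363}}{1026},\ \frac1{32},\ 1$ | $\frac{17508632031}{65602}\pm\frac{1492406775}{2689682}\sqrt{231363},\ \frac{17473470464}{32801},\ 1$ | Then $f(x)=(x-t_1)^2\cdots(x-t_{m-2})^2(x-t_{m-1})$ satisfies the above conditions for the two-point bound and $f(1)/f_0=B$. Also $-1\le t_1<\dots<t_m=1$, $t_{m-1}=\cos\theta$, all $w_j\ge 0$, $w_m=1$, $\sum_{j=1}^m w_jC_k^{n/2-1}(t_j)\ge 0$ for all $k\ge 0$, and $\sum_{j=1}^m w_j=B$. -/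

import Mathlib

open Polynomial

noncomputable section

/-- The Gegenbauer polynomials `C_k^l`, by the three-term recurrence. They are the polynomials with
generating function `(1 - 2xz + z^2)^(-l) = ∑ k, C_k^l(x) z^k`,
see `gegenbauer_generatingFunction`. -/
def gegenbauer (l : ℝ) : ℕ → ℝ[X]
  | 0 => 1
  | 1 => C (2 * l) * X
  | k + 2 => C (2 * ((k : ℝ) + 1 + l) / ((k : ℝ) + 2)) * X * gegenbauer l (k + 1) -
      C (((k : ℝ) + 2 * l) / ((k : ℝ) + 2)) * gegenbauer l k

/-- Taylor coefficients at `0` of `z * h z`. -/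
theorem iteratedDeriv_id_mul_zero (k : ℕ) : ∀ h : ℝ → ℝ, AnalyticAt ℝ h 0 →
    iteratedDeriv (k + 1) (fun z => z * h z) 0 = (k + 1) * iteratedDeriv k h 0 := by
  have key : ∀ h : ℝ → ℝ, AnalyticAt ℝ h 0 →
      deriv (fun z => z * h z) =ᶠ[nhds 0] (h + fun z => z * deriv h z) := by
    intro h hh
    filter_upwards [hh.eventually_analyticAt] with z hz
    rw [deriv_fun_mul differentiableAt_fun_id hz.differentiableAt]
    simp
  induction k with
  | zero =>
    intro h hh
    rw [zero_add, iteratedDeriv_one, (key h hh).eq_of_nhds]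
    simp
  | succ k ih =>
    intro h hh
    have hz : AnalyticAt ℝ (fun z => z * deriv h z) 0 := analyticAt_id.mul hh.deriv
    rw [iteratedDeriv_succ', (key h hh).iteratedDeriv_eq, iteratedDeriv_add hh.contDiffAt
      hz.contDiffAt, ih _ hh.deriv, ← iteratedDeriv_succ']
    push_cast
    ring

/-- The generating function of the Gegenbauer polynomials. -/
theorem gegenbauer_generatingFunction (l x : ℝ) :
    ∀ᶠ z in nhds (0 : ℝ), HasSum (fun k : ℕ => (gegenbauer l k).eval x * z ^ k)
      (1 / (1 - 2 * x * z + z ^ 2) ^ l) := by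
  set q : ℝ → ℝ := fun z => 1 - 2 * x * z + z ^ 2 with hq
  set g : ℝ → ℝ := fun z => q z ^ (-l) with hg
  have hqc : Continuous q := by fun_prop
  have hpos : ∀ᶠ z in nhds (0 : ℝ), 0 < q z :=
    hqc.continuousAt.eventually (lt_mem_nhds (by simp [hq]))
  have hga : AnalyticAt ℝ g 0 := by
    rw [← analyticWithinAt_univ, ← contDiffWithinAt_omega_iff_analyticWithinAt, contDiffWithinAt_univ]
    refine ContDiffAt.rpow_const_of_ne ?_ (by simp [hq])
    exact ContDiff.contDiffAt (by fun_prop)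
  have hg0 : g 0 = 1 := by simp [hg, hq]
  have hder : ∀ᶠ z in nhds (0 : ℝ), q z * deriv g z = 2 * l * ((x - z) * g z) := by
    filter_upwards [hpos] with z hz
    have h1 : HasDerivAt q (-2 * x + 2 * z) z := by
      have h := (((hasDerivAt_id z).const_mul (2 * x)).const_sub 1).add ((hasDerivAt_id z).pow 2)
      refine (h.congr_deriv ?_)
      simp
    have h2 := h1.rpow_const (p := -l) (Or.inl hz.ne')
    rw [h2.deriv, Real.rpow_sub hz, Real.rpow_one]
    simp only [hg]
    field_simp
    ring
  set a : ℕ → ℝ := fun k => iteratedDeriv k g 0 with ha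
  have hdg := hga.deriv
  have hzg : AnalyticAt ℝ (fun z => z * g z) 0 := analyticAt_id.mul hga
  have hzdg : AnalyticAt ℝ (fun z => z * deriv g z) 0 := analyticAt_id.mul hdg
  have hzzdg : AnalyticAt ℝ (fun z => z * (z * deriv g z)) 0 := analyticAt_id.mul hzdg
  have hode : (deriv g + fun z => z * (z * deriv g z)) =ᶠ[nhds 0]
      ((fun z => 2 * x * (z * deriv g z)) +
        ((fun z => 2 * l * x * g z) + fun z => -(2 * l) * (z * g z))) := by
    filter_upwards [hder] with z hz
    simp only [Pi.add_apply, hq] at hz ⊢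
    linear_combination hz
  have hstep : ∀ k, iteratedDeriv k (deriv g) 0 + iteratedDeriv k (fun z => z * (z * deriv g z)) 0
      = 2 * x * iteratedDeriv k (fun z => z * deriv g z) 0 + (2 * l * x * iteratedDeriv k g 0
        + -(2 * l) * iteratedDeriv k (fun z => z * g z) 0) := by
    intro k
    have := hode.iteratedDeriv_eq k
    have e1 : AnalyticAt ℝ (fun z => 2 * x * (z * deriv g z)) 0 := analyticAt_const.mul hzdg
    have e2 : AnalyticAt ℝ (fun z => 2 * l * x * g z) 0 := analyticAt_const.mul hga
    have e3 : AnalyticAt ℝ (fun z => -(2 * l) * (z * g z)) 0 := analyticAt_const.mul hzg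
    rw [iteratedDeriv_add hdg.contDiffAt hzzdg.contDiffAt,
      iteratedDeriv_add e1.contDiffAt (e2.add e3).contDiffAt,
      iteratedDeriv_add e2.contDiffAt e3.contDiffAt] at this
    simpa only [iteratedDeriv_const_mul_field] using this
  have hrec0 : a 1 = 2 * l * x := by
    have := hstep 0
    simp only [iteratedDeriv_zero] at this
    simp only [ha, iteratedDeriv_one]
    simpa [hg0] using this
  have hrec : ∀ k : ℕ, a (k + 2) = 2 * x * (k + 1 + l) * a (k + 1) -
      (k + 1) * (k + 2 * l) * a k := by
    intro k
    have h := hstep (k + 1)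
    rw [iteratedDeriv_id_mul_zero k _ hzdg, iteratedDeriv_id_mul_zero k _ hdg,
      iteratedDeriv_id_mul_zero k _ hga, ← iteratedDeriv_succ', ← iteratedDeriv_succ'] at h
    cases k with
    | zero =>
      simp only [iteratedDeriv_zero] at h
      simp only [ha, iteratedDeriv_zero]
      push_cast at h ⊢
      linear_combination h
    | succ k =>
      rw [iteratedDeriv_id_mul_zero k _ hdg, ← iteratedDeriv_succ'] at h
      simp only [ha]
      push_cast at h ⊢
      linear_combination h
  have hcoef : ∀ k : ℕ, a k = (k.factorial : ℝ) * (gegenbauer l k).eval x ∧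
      a (k + 1) = ((k + 1).factorial : ℝ) * (gegenbauer l (k + 1)).eval x := by
    intro k
    induction k with
    | zero =>
      refine ⟨by simp [ha, hg0, gegenbauer], ?_⟩
      simp [hrec0, gegenbauer]
    | succ k ih =>
      refine ⟨ih.2, ?_⟩
      rw [hrec k, ih.1, ih.2]
      have h2 : (k : ℝ) + 2 ≠ 0 := by positivity
      simp only [gegenbauer, Nat.factorial_succ, eval_sub, eval_mul, eval_C, eval_X]
      push_cast
      field_simp
      ring
  have hs := hasFPowerSeriesAt_iff.1 hga.hasFPowerSeriesAt
  filter_upwards [hs, hpos] with z hz hzpos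
  rw [zero_add] at hz
  have h1 : g z = 1 / (1 - 2 * x * z + z ^ 2) ^ l := by
    simp only [hg]
    rw [Real.rpow_neg hzpos.le, one_div]
  rw [← h1]
  refine hz.congr_fun ?_
  intro k
  have := (hcoef k).1
  simp only [ha] at this
  simp [FormalMultilinearSeries.coeff_ofScalars, this]
  field_simp

/-- `C` is a spherical code in `S^(n-1)` whose minimal angle has cosine `c`: `C` is a finite set
of unit vectors, and `c` is the largest inner product between distinct points of `C`. -/
structure IsSphericalCode {n : ℕ} (C : Finset (EuclideanSpace ℝ (Fin n))) (c : ℝ) : Prop where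
  norm_eq_one : ∀ x ∈ C, ‖x‖ = 1
  isGreatest : IsGreatest {s : ℝ | ∃ x ∈ C, ∃ y ∈ C, x ≠ y ∧ s = inner ℝ x y} c

/-- `f = ∑ k ≤ d, a k • C_k^(n/2-1)` is feasible for the two-point (Delsarte linear programming)
bound for spherical codes in `S^(n-1)` with minimal angle `arccos c`. -/
structure IsTwoPointFeasible (n : ℕ) (c : ℝ) (f : ℝ[X]) (d : ℕ) (a : ℕ → ℝ) : Prop where
  nonpos : ∀ x : ℝ, -1 ≤ x → x ≤ c → f.eval x ≤ 0
  expansion : f = ∑ k ∈ Finset.range (d + 1), Polynomial.C (a k) * gegenbauer ((n : ℝ) / 2 - 1) k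
  coeff_nonneg : ∀ k ≤ d, 0 ≤ a k
  coeff_zero_pos : 0 < a 0

/-- The values `f(1)/f_0` whose infimum is the two-point bound for spherical codes in `S^(n-1)`
with minimal angle `arccos c`. -/
def twoPointValues (n : ℕ) (c : ℝ) : Set ℝ :=
  {r | ∃ (f : ℝ[X]) (d : ℕ) (a : ℕ → ℝ), IsTwoPointFeasible n c f d a ∧ r = f.eval 1 / a 0}

/-- `b` is the two-point bound for spherical codes in `S^(n-1)` with minimal angle `arccos c`. -/
def IsTwoPointBound (n : ℕ) (c b : ℝ) : Prop :=
  IsGLB (twoPointValues n c) b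

/-- The two-point bound is sharp for the code `C`: it equals the number of points of `C`. -/
def IsTwoPointSharp {n : ℕ} (C : Finset (EuclideanSpace ℝ (Fin n))) : Prop :=
  ∃ c : ℝ, IsSphericalCode C c ∧ IsTwoPointBound n c (C.card : ℝ)

/-- Cosines `t_1 < ... < t_m` and weights `w_1, ..., w_m` (here `m = p + 2`) that give the dual
two-point bound `∑ j, w_j` for spherical codes in `S^(n-1)` with minimal angle `arccos c`. -/
structure IsDualTwoPoint (n : ℕ) (c : ℝ) {p : ℕ} (t w : Fin (p + 2) → ℝ) : Prop where
  neg_one_le : ∀ j, -1 ≤ t j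
  strictMono : StrictMono t
  cosine_last : t (Fin.last (p + 1)) = 1
  cosine_penultimate : t (Fin.last p).castSucc = c
  weight_nonneg : ∀ j, 0 ≤ w j
  weight_last : w (Fin.last (p + 1)) = 1
  positivity : ∀ k : ℕ, 0 ≤ ∑ j, w j * (gegenbauer ((n : ℝ) / 2 - 1) k).eval (t j)

/-- The polynomial `(x-t_1)^2 ... (x-t_(m-2))^2 (x-t_(m-1))`, where `m = p + 2`. -/
def primalPolynomial {p : ℕ} (t : Fin (p + 2) → ℝ) : ℝ[X] :=
  (∏ j : Fin p, (X - Polynomial.C (t j.castSucc.castSucc)) ^ 2) *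
    (X - Polynomial.C (t (Fin.last p).castSucc))

/-- A line of data: codes with `N` points in `ℝ^n` and maximal cosine `cosine`, the claimed value
`bound` of the two-point bound, and the cosines `t` and weights `w` of a dual certificate. -/
structure TwoPointCase where
  n : ℕ
  N : ℕ
  cosine : ℝ
  bound : ℝ
  p : ℕ
  t : Fin (p + 2) → ℝ
  w : Fin (p + 2) → ℝ

/-- The Nordstrom-Robinson spherical code, the codes from the Gewirtz, Hoffman-Singleton and
`M_22` graphs, and the Kerdock spherical codes in dimensions 64, 256 and 1024. -/
def twoPointTable : List TwoPointCase :=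
  [ { n := 16, N := 288, cosine := 1 / 4, bound := 312, p := 2
      t := ![-1 / 2 - √3 / 6, -1 / 2 + √3 / 6, 1 / 4, 1]
      w := ![3825 / 46 - 2115 / 46 * √3, 3825 / 46 + 2115 / 46 * √3, 3328 / 23, 1] },
    { n := 20, N := 56, cosine := 1 / 15, bound := 31416 / 451, p := 1
      t := ![-16 / 35, 1 / 15, 1]
      w := ![4802 / 451, 26163 / 451, 1] },
    { n := 21, N := 50, cosine := 1 / 21, bound := 64, p := 1
      t := ![-11 / 21, 1 / 21, 1]
      w := ![7, 56, 1] },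
    { n := 21, N := 77, cosine := 1 / 12, bound := 74382 / 861, p := 1
      t := ![-13 / 33, 1 / 12, 1]
      w := ![14641 / 861, 58880 / 861, 1] },
    { n := 64, N := 4224, cosine := 1 / 8, bound := 4448, p := 2
      t := ![-1 / 2 - √627 / 66, -1 / 2 + √627 / 66, 1 / 8, 1]
      w := ![1178199 / 1042 - 892485 / 19798 * √627, 1178199 / 1042 + 892485 / 19798 * √627,
        1138688 / 521, 1] },
    { n := 256, N := 66048, cosine := 1 / 16, bound := 67968, p := 2
      t := ![-1 / 2 - √1419 / 86, -1 / 2 + √1419 / 86, 1 / 16, 1]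
      w := ![15594423 / 914 - 4553399 / 10054 * √1419, 15594423 / 914 + 4553399 / 10054 * √1419,
        15466496 / 457, 1] },
    { n := 1024, N := 1050624, cosine := 1 / 32, bound := 1066496, p := 2
      t := ![-1 / 2 - √231363 / 1026, -1 / 2 + √231363 / 1026, 1 / 32, 1]
      w := ![17508632031 / 65602 - 1492406775 / 2689682 * √231363,
        17508632031 / 65602 + 1492406775 / 2689682 * √231363, 17473470464 / 32801, 1] } ]

end

/-! The bound is certified by linear programming duality. If `f` is feasible and `t`, `w` is a dual
solution, evaluate `∑ j, w j * f (t j)` in two ways. Every node except `1` lies in `[-1, c]`, where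
`f ≤ 0`, so the sum is at most `f(1)`. Expanding `f` in Gegenbauer polynomials, every degree
contributes a nonnegative amount, so the sum is at least `f_0 * ∑ j, w j`. This is
`IsDualTwoPoint.sum_le`. For the tabulated data `f` vanishes at every node except `1`, and the
weighted sums of `C_k` vanish for `1 ≤ k ≤ deg f`, so both estimates are equalities.

The only infinite condition is dual positivity in every degree. Normalize the polynomials to `P_k(1)
= 1`, so that the node `1` contributes exactly `1`. At a node `x` in `(-1, 1)` a quadratic form in
`P_k(x)`, `P_{k+1}(x)` decreases with `k` and dominates `(1 - x^2) P_{k+1}(x)^2`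
(`gegenbauerEnergy_antitone`, `abs_normGegenbauer_le`). Hence one value of the form, in degree `K`,
bounds `|P_k(x)|` for all `k > K`. Once the weighted bounds add up to at most `1`, only the degrees
up to `K` remain to be checked (`dual_positivity`).

In the four-node cases two nodes and their weights are conjugate in a real quadratic field.
Calculations there use pairs of rational numbers, and square roots remain only in inequalities
linear in them. -/

/-! ### Normalized Gegenbauer polynomials and their decay in the degree. -/

/-- The Gegenbauer polynomials evaluated at `x` and normalized to take the value `1` at `1`. -/
noncomputable def normGegenbauer (l x : ℝ) : ℕ → ℝ
  | 0 => 1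
  | 1 => x
  | k + 2 => (2 * (k + 1 + l) * x * normGegenbauer l x (k + 1) -
      (k + 1) * normGegenbauer l x k) / (k + 1 + 2 * l)

/-- The value of the Gegenbauer polynomial `C_k^l` at `1`. -/
noncomputable def gegenbauerAtOne (l : ℝ) : ℕ → ℝ
  | 0 => 1
  | k + 1 => gegenbauerAtOne l k * (k + 2 * l) / (k + 1)

theorem gegenbauerAtOne_pos {l : ℝ} (hl : 0 < l) (k : ℕ) : 0 < gegenbauerAtOne l k := by
  induction k with
  | zero => simp [gegenbauerAtOne]
  | succ k ih => rw [gegenbauerAtOne]; positivity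

theorem eval_gegenbauer {l : ℝ} (hl : 0 < l) (x : ℝ) (k : ℕ) :
    (gegenbauer l k).eval x = gegenbauerAtOne l k * normGegenbauer l x k := by
  induction k using Nat.twoStepInduction with
  | zero => simp [gegenbauer, gegenbauerAtOne, normGegenbauer]
  | one => simp [gegenbauer, gegenbauerAtOne, normGegenbauer]
  | more k ih ih' =>
    have h1 : (k : ℝ) + 1 + 2 * l ≠ 0 := by positivity
    have h2 : (k : ℝ) + 2 ≠ 0 := by positivity
    simp only [gegenbauer, eval_sub, eval_mul, eval_C, eval_X, ih, ih', normGegenbauer,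
      gegenbauerAtOne]
    push_cast
    field_simp
    ring

theorem normGegenbauer_at_one {l : ℝ} (hl : 0 < l) (k : ℕ) : normGegenbauer l 1 k = 1 := by
  induction k using Nat.twoStepInduction with
  | zero => rfl
  | one => rfl
  | more k ih ih' =>
    have h1 : (k : ℝ) + 1 + 2 * l ≠ 0 := by positivity
    rw [normGegenbauer, ih, ih', div_eq_one_iff_eq h1]
    ring

/-- A quadratic form in two consecutive normalized Gegenbauer polynomials, nonincreasing in
the degree on `[-1, 1]`. -/
noncomputable def gegenbauerEnergy (l x : ℝ) (k : ℕ) : ℝ :=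
  normGegenbauer l x (k + 1) ^ 2 - 2 * x * normGegenbauer l x (k + 1) * normGegenbauer l x k +
    normGegenbauer l x k ^ 2

/-- With `p`, `q` the values in degrees `k`, `k + 1`, the energy is `(x q - p)^2 + (1 - x^2) q^2`.
The recurrence reads `r = x q + B (x q - p)` with `0 ≤ B ≤ 1`, so the next energy is `B^2 (x q -
p)^2 + (1 - x^2) q^2`. -/
theorem gegenbauerEnergy_antitone {l x : ℝ} (hl : 0 < l) :
    Antitone (gegenbauerEnergy l x) := by
  refine antitone_nat_of_succ_le fun k => ?_
  set p := normGegenbauer l x k with hp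
  set q := normGegenbauer l x (k + 1) with hq
  have h1 : 0 < (k : ℝ) + 1 + 2 * l := by positivity
  set B : ℝ := (k + 1) / (k + 1 + 2 * l) with hB
  have hB0 : 0 ≤ B := by positivity
  have hB1 : B ≤ 1 := by rw [hB, div_le_one h1]; linarith
  have hr : normGegenbauer l x (k + 2) = x * q + B * (x * q - p) := by
    rw [normGegenbauer, ← hp, ← hq, hB]
    field_simp
    ring
  have hsq : B ^ 2 ≤ 1 := pow_le_one₀ hB0 hB1
  simp only [gegenbauerEnergy, hr, ← hp, ← hq]
  nlinarith [mul_nonneg (sub_nonneg.2 hsq) (sq_nonneg (x * q - p))]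

/-- Completing the square in the energy of degree `k - 1` leaves at least `(1 - x^2) P_k(x)^2`. The
index shift is why the bound starts at `K + 1`. -/
theorem abs_normGegenbauer_le {l x b : ℝ} {K k : ℕ} (hl : 0 < l) (hx : x ^ 2 < 1) (hb : 0 ≤ b)
    (hK : gegenbauerEnergy l x K ≤ (1 - x ^ 2) * b ^ 2) (hk : K < k) :
    |normGegenbauer l x k| ≤ b := by
  obtain ⟨m, rfl⟩ : ∃ m, k = m + 1 := ⟨k - 1, by omega⟩
  have h := (gegenbauerEnergy_antitone (x := x) hl (show K ≤ m by omega)).trans hK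
  refine abs_le_of_sq_le_sq ?_ hb
  refine le_of_mul_le_mul_left ?_ (sub_pos.2 hx)
  refine le_trans ?_ h
  simp only [gegenbauerEnergy]
  nlinarith [sq_nonneg (x * normGegenbauer l x (m + 1) - normGegenbauer l x m)]

/-! ### Dual positivity and linear programming duality. -/

/-- Positivity of a dual certificate in all degrees follows from positivity in degrees at most `K`
and bounds on the energy in degree `K`. -/
theorem dual_positivity {n p : ℕ} (hn : 2 < n) {t w : Fin (p + 2) → ℝ}
    (b : Fin (p + 1) → ℝ) (K : ℕ)
    (ht : t (Fin.last (p + 1)) = 1) (hw : w (Fin.last (p + 1)) = 1)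
    (hw0 : ∀ j : Fin (p + 1), 0 ≤ w j.castSucc)
    (ht1 : ∀ j : Fin (p + 1), t j.castSucc ^ 2 < 1) (hb : ∀ j, 0 ≤ b j)
    (hE : ∀ j : Fin (p + 1), gegenbauerEnergy ((n : ℝ) / 2 - 1) (t j.castSucc) K ≤
      (1 - t j.castSucc ^ 2) * b j ^ 2)
    (hsum : ∑ j : Fin (p + 1), w j.castSucc * b j ≤ 1)
    (hsmall : ∀ k ≤ K, 0 ≤ ∑ j, w j * normGegenbauer ((n : ℝ) / 2 - 1) (t j) k) (k : ℕ) :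
    0 ≤ ∑ j, w j * (gegenbauer ((n : ℝ) / 2 - 1) k).eval (t j) := by
  have hl : (0 : ℝ) < (n : ℝ) / 2 - 1 := by
    have : (2 : ℝ) < n := by exact_mod_cast hn
    linarith
  have key : 0 ≤ ∑ j, w j * normGegenbauer ((n : ℝ) / 2 - 1) (t j) k := by
    rcases le_or_gt k K with hk | hk
    · exact hsmall k hk
    -- The node `1` contributes exactly `1`; the other nodes subtract at most `∑ w b ≤ 1`.
    rw [Fin.sum_univ_castSucc, ht, hw, normGegenbauer_at_one hl]
    have : -∑ j : Fin (p + 1), w j.castSucc * b j ≤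
        ∑ j : Fin (p + 1), w j.castSucc * normGegenbauer ((n : ℝ) / 2 - 1) (t j.castSucc) k := by
      rw [← Finset.sum_neg_distrib]
      refine Finset.sum_le_sum fun j _ => ?_
      rw [← mul_neg]
      exact mul_le_mul_of_nonneg_left
        (neg_le_of_abs_le (abs_normGegenbauer_le hl (ht1 j) (hb j) (hE j) hk)) (hw0 j)
    linarith
  have : ∑ j, w j * (gegenbauer ((n : ℝ) / 2 - 1) k).eval (t j) =
      gegenbauerAtOne ((n : ℝ) / 2 - 1) k *
        ∑ j, w j * normGegenbauer ((n : ℝ) / 2 - 1) (t j) k := by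
    rw [Finset.mul_sum]
    refine Finset.sum_congr rfl fun j _ => ?_
    rw [eval_gegenbauer hl]
    ring
  rw [this]
  exact mul_nonneg (gegenbauerAtOne_pos hl k).le key

/-- Weak duality for the two-point bound. -/
theorem IsDualTwoPoint.sum_le {n p : ℕ} {c : ℝ} {t w : Fin (p + 2) → ℝ}
    (h : IsDualTwoPoint n c t w) {f : ℝ[X]} {d : ℕ} {a : ℕ → ℝ}
    (hf : IsTwoPointFeasible n c f d a) : ∑ j, w j ≤ f.eval 1 / a 0 := by
  rw [le_div_iff₀ hf.coeff_zero_pos]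
  have h1 : ∑ j, w j * f.eval (t j) ≤ f.eval 1 := by
    rw [Fin.sum_univ_castSucc, h.cosine_last, h.weight_last]
    have : ∑ j : Fin (p + 1), w j.castSucc * f.eval (t j.castSucc) ≤ 0 := by
      refine Finset.sum_nonpos fun j _ => mul_nonpos_of_nonneg_of_nonpos (h.weight_nonneg _) ?_
      refine hf.nonpos _ (h.neg_one_le _) ?_
      rw [← h.cosine_penultimate]
      exact h.strictMono.monotone (by simpa using Fin.le_last j)
    linarith
  have h2 : ∑ j, w j * f.eval (t j) = ∑ k ∈ Finset.range (d + 1),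
      a k * ∑ j, w j * (gegenbauer ((n : ℝ) / 2 - 1) k).eval (t j) := by
    simp_rw [Finset.mul_sum]
    rw [Finset.sum_comm]
    refine Finset.sum_congr rfl fun j _ => ?_
    rw [hf.expansion, eval_finsetSum, Finset.mul_sum]
    refine Finset.sum_congr rfl fun k _ => ?_
    simp only [eval_mul, eval_C]
    ring
  -- Only the degree `0` term is kept, where `C_0 = 1`; the others are nonnegative.
  have h3 : a 0 * ∑ j, w j ≤ ∑ k ∈ Finset.range (d + 1),
      a k * ∑ j, w j * (gegenbauer ((n : ℝ) / 2 - 1) k).eval (t j) := by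
    refine le_trans (le_of_eq ?_) (Finset.single_le_sum (f := fun k => a k * ∑ j, w j *
      (gegenbauer ((n : ℝ) / 2 - 1) k).eval (t j)) (fun k hk => mul_nonneg
        (hf.coeff_nonneg k (by simpa [Nat.lt_succ_iff] using hk)) (h.positivity k))
      (Finset.mem_range.2 d.succ_pos))
    simp [gegenbauer]
  linarith

theorem isTwoPointBound_of_certificates {n p : ℕ} {c B : ℝ} {t w : Fin (p + 2) → ℝ}
    (h : IsDualTwoPoint n c t w) (hB : ∑ j, w j = B)
    (hf : ∃ (f : ℝ[X]) (d : ℕ) (a : ℕ → ℝ),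
      IsTwoPointFeasible n c f d a ∧ f.eval 1 / a 0 = B) : IsTwoPointBound n c B := by
  refine ⟨?_, fun b hb => ?_⟩
  · rintro r ⟨f, d, a, hfa, rfl⟩
    exact hB ▸ h.sum_le hfa
  · obtain ⟨f, d, a, hfa, rfl⟩ := hf
    exact hb ⟨f, d, a, hfa, rfl⟩

theorem IsTwoPointBound.not_sharp {n : ℕ} {c B : ℝ} (h : IsTwoPointBound n c B)
    {C : Finset (EuclideanSpace ℝ (Fin n))} (hC : IsSphericalCode C c) (hB : (C.card : ℝ) < B) :
    ¬ IsTwoPointSharp C := by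
  rintro ⟨c', hC', hb⟩
  -- The code determines its own maximal cosine, so sharpness cannot refer to another angle.
  obtain rfl := hC'.isGreatest.unique hC.isGreatest
  exact hB.ne (IsGLB.unique hb h)

theorem primalPolynomial_nonpos {p : ℕ} (t : Fin (p + 2) → ℝ) {x : ℝ}
    (hx : x ≤ t (Fin.last p).castSucc) : (primalPolynomial t).eval x ≤ 0 := by
  rw [primalPolynomial, eval_mul, eval_prod]
  refine mul_nonpos_of_nonneg_of_nonpos (Finset.prod_nonneg fun j _ => ?_) (by simpa using hx)
  rw [eval_pow]
  exact sq_nonneg _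

/-- The data of a line of the table give matching primal and dual solutions of the two-point bound,
whose common value exceeds the number of points. -/
structure TwoPointCase.IsValid (r : TwoPointCase) : Prop where
  lt_bound : (r.N : ℝ) < r.bound
  feasible : ∃ (d : ℕ) (a : ℕ → ℝ), IsTwoPointFeasible r.n r.cosine (primalPolynomial r.t) d a ∧
    (primalPolynomial r.t).eval 1 / a 0 = r.bound
  dual : IsDualTwoPoint r.n r.cosine r.t r.w
  sum_weight : ∑ j, r.w j = r.bound

/-! ### Arithmetic at quadratic irrational nodes, and criteria for three and four nodes. -/

/-- The pair `(u, v)` with `normGegenbauer l (a + b * s) k = u + v * s` whenever `s ^ 2 = D`. -/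
noncomputable def normGegenbauerPair (l a b D : ℝ) : ℕ → ℝ × ℝ
  | 0 => (1, 0)
  | 1 => (a, b)
  | k + 2 =>
    ((2 * (k + 1 + l) * (a * (normGegenbauerPair l a b D (k + 1)).1 +
        b * (normGegenbauerPair l a b D (k + 1)).2 * D) -
      (k + 1) * (normGegenbauerPair l a b D k).1) / (k + 1 + 2 * l),
    (2 * (k + 1 + l) * (a * (normGegenbauerPair l a b D (k + 1)).2 +
        b * (normGegenbauerPair l a b D (k + 1)).1) -
      (k + 1) * (normGegenbauerPair l a b D k).2) / (k + 1 + 2 * l))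

/-- Only `s ^ 2 = D` is assumed, so one pair serves both `√D` and `-√D`, that is, both conjugate
nodes. -/
theorem normGegenbauer_eq_pair (l a b : ℝ) {s D : ℝ} (hs : s ^ 2 = D) (k : ℕ) :
    normGegenbauer l (a + b * s) k =
      (normGegenbauerPair l a b D k).1 + (normGegenbauerPair l a b D k).2 * s := by
  induction k using Nat.twoStepInduction with
  | zero => simp [normGegenbauer, normGegenbauerPair]
  | one => simp [normGegenbauer, normGegenbauerPair]
  | more k ih ih' =>
    simp only [normGegenbauer, normGegenbauerPair, ih, ih', ← hs]
    ring

/-- Three-point dual certificates. -/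
theorem isDualTwoPoint_three {n : ℕ} {c t u v : ℝ} (b b' : ℝ) (K : ℕ) (hn : 2 < n)
    (ht : -1 < t) (htc : t < c) (hc : c < 1) (hu : 0 ≤ u) (hv : 0 ≤ v) (hb : 0 ≤ b) (hb' : 0 ≤ b')
    (hE : gegenbauerEnergy ((n : ℝ) / 2 - 1) t K ≤ (1 - t ^ 2) * b ^ 2)
    (hE' : gegenbauerEnergy ((n : ℝ) / 2 - 1) c K ≤ (1 - c ^ 2) * b' ^ 2)
    (hsum : u * b + v * b' ≤ 1)
    (hsmall : ∀ k ≤ K, 0 ≤ u * normGegenbauer ((n : ℝ) / 2 - 1) t k +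
      v * normGegenbauer ((n : ℝ) / 2 - 1) c k + 1) :
    IsDualTwoPoint n c (p := 1) ![t, c, 1] ![u, v, 1] where
  neg_one_le j := by fin_cases j <;> simp <;> linarith
  strictMono := by
    refine Fin.strictMono_iff_lt_succ.2 fun j => ?_
    fin_cases j <;> simpa
  cosine_last := rfl
  cosine_penultimate := rfl
  weight_nonneg j := by fin_cases j <;> simp [hu, hv]
  weight_last := rfl
  positivity := by
    have hl : (0 : ℝ) < (n : ℝ) / 2 - 1 := by
      have : (2 : ℝ) < n := by exact_mod_cast hn
      linarith
    refine dual_positivity hn ![b, b'] K rfl rfl ?_ ?_ ?_ ?_ ?_ fun k hk => ?_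
    · intro j; fin_cases j <;> simp [hu, hv]
    · intro j; fin_cases j <;> simp only [sq_lt_one_iff_abs_lt_one, abs_lt] <;> constructor <;>
        simp <;> linarith
    · intro j; fin_cases j <;> simp [hb, hb']
    · intro j; fin_cases j <;> simp [hE, hE']
    · simpa [Fin.sum_univ_succ] using hsum
    · have := hsmall k hk
      simp only [Fin.sum_univ_succ, Fin.sum_univ_zero]
      simp [normGegenbauer_at_one hl]
      linarith

theorem eval_primalPolynomial_three (t c x : ℝ) :
    (primalPolynomial (p := 1) ![t, c, 1]).eval x = (x - t) ^ 2 * (x - c) := by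
  simp [primalPolynomial]

/-- Four-point dual certificates, where the first two cosines and weights are conjugate. -/
theorem isDualTwoPoint_four {n : ℕ} {c α β u v x D s : ℝ} (b b' b'' : ℝ) (K : ℕ) (hn : 2 < n)
    (hs : s ^ 2 = D) (ht : -1 < α - β * s) (htt : 0 < β * s) (htc : α + β * s < c) (hc : c < 1)
    (hu : 0 ≤ u - v * s) (hu' : 0 ≤ u + v * s) (hx : 0 ≤ x)
    (hb : 0 ≤ b) (hb' : 0 ≤ b') (hb'' : 0 ≤ b'')
    (hE : gegenbauerEnergy ((n : ℝ) / 2 - 1) (α - β * s) K ≤ (1 - (α - β * s) ^ 2) * b ^ 2)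
    (hE' : gegenbauerEnergy ((n : ℝ) / 2 - 1) (α + β * s) K ≤ (1 - (α + β * s) ^ 2) * b' ^ 2)
    (hE'' : gegenbauerEnergy ((n : ℝ) / 2 - 1) c K ≤ (1 - c ^ 2) * b'' ^ 2)
    (hsum : (u - v * s) * b + (u + v * s) * b' + x * b'' ≤ 1)
    (hsmall : ∀ k ≤ K, 0 ≤ 2 * (u * (normGegenbauerPair ((n : ℝ) / 2 - 1) α β D k).1 +
      v * (normGegenbauerPair ((n : ℝ) / 2 - 1) α β D k).2 * D) +
      x * normGegenbauer ((n : ℝ) / 2 - 1) c k + 1) :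
    IsDualTwoPoint n c (p := 2) ![α - β * s, α + β * s, c, 1] ![u - v * s, u + v * s, x, 1] where
  neg_one_le j := by fin_cases j <;> simp <;> linarith
  strictMono := by
    refine Fin.strictMono_iff_lt_succ.2 fun j => ?_
    fin_cases j <;> simp <;> linarith
  cosine_last := rfl
  cosine_penultimate := rfl
  weight_nonneg j := by fin_cases j <;> simp <;> linarith
  weight_last := rfl
  positivity := by
    have hl : (0 : ℝ) < (n : ℝ) / 2 - 1 := by
      have : (2 : ℝ) < n := by exact_mod_cast hn
      linarith
    refine dual_positivity hn ![b, b', b''] K rfl rfl ?_ ?_ ?_ ?_ ?_ fun k hk => ?_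
    · intro j; fin_cases j <;> simp <;> linarith
    · intro j; fin_cases j <;> simp only [sq_lt_one_iff_abs_lt_one, abs_lt] <;> constructor <;>
        simp <;> linarith
    · intro j; fin_cases j <;> simp [hb, hb', hb'']
    · intro j
      fin_cases j
      exacts [hE, hE', hE'']
    · simpa [Fin.sum_univ_succ, add_assoc] using hsum
    · refine (hsmall k hk).trans_eq ?_
      have h1 := normGegenbauer_eq_pair ((n : ℝ) / 2 - 1) α β hs k
      -- Conjugate nodes carry conjugate weights, so the terms odd in `s` cancel and `hsmall` is
      -- free of square roots.
      have h2 := normGegenbauer_eq_pair ((n : ℝ) / 2 - 1) α β (s := -s) ((neg_sq s).trans hs) k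
      rw [mul_neg, ← sub_eq_add_neg] at h2
      rw [Fin.sum_univ_four]
      change _ = (u - v * s) * normGegenbauer _ (α - β * s) k +
        (u + v * s) * normGegenbauer _ (α + β * s) k + x * normGegenbauer _ c k +
        1 * normGegenbauer _ 1 k
      rw [h1, h2, normGegenbauer_at_one hl, ← hs]
      ring

/-- The rational part of the energy at `a + b * s`, where `s ^ 2 = D`. -/
noncomputable def energyRat (a b D : ℝ) (y z : ℝ × ℝ) : ℝ :=
  z.1 ^ 2 + z.2 ^ 2 * D - 2 * (a * (z.1 * y.1 + z.2 * y.2 * D) + b * D * (z.1 * y.2 + z.2 * y.1)) +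
    (y.1 ^ 2 + y.2 ^ 2 * D)

/-- The coefficient of `s` in the energy at `a + b * s`, where `s ^ 2 = D`. -/
noncomputable def energyIrr (a b D : ℝ) (y z : ℝ × ℝ) : ℝ :=
  2 * z.1 * z.2 - 2 * (a * (z.1 * y.2 + z.2 * y.1) + b * (z.1 * y.1 + z.2 * y.2 * D)) +
    2 * y.1 * y.2

theorem gegenbauerEnergy_eq_pair (l a b : ℝ) {s D : ℝ} (hs : s ^ 2 = D) (k : ℕ) :
    gegenbauerEnergy l (a + b * s) k =
      energyRat a b D (normGegenbauerPair l a b D k) (normGegenbauerPair l a b D (k + 1)) +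
      energyIrr a b D (normGegenbauerPair l a b D k) (normGegenbauerPair l a b D (k + 1)) * s := by
  simp only [gegenbauerEnergy, normGegenbauer_eq_pair l a b hs, energyRat, energyIrr, ← hs]
  ring

/-- Both sides are reduced to expressions linear in `s`, so that decimal bounds on the square root
decide the inequality. -/
theorem energy_le_of_pair {l a b s D B : ℝ} {k : ℕ} (hs : s ^ 2 = D) (y z : ℝ × ℝ)
    (hy : normGegenbauerPair l a b D k = y) (hz : normGegenbauerPair l a b D (k + 1) = z)
    (h : energyRat a b D y z + energyIrr a b D y z * s ≤ (1 - a ^ 2 - b ^ 2 * D - 2 * a * b * s) *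
      B) : gegenbauerEnergy l (a + b * s) k ≤ (1 - (a + b * s) ^ 2) * B := by
  rw [gegenbauerEnergy_eq_pair l a b hs, hy, hz]
  refine h.trans_eq ?_
  rw [← hs]
  ring

/-! ### Three-node certificates: the Gewirtz, Hoffman-Singleton and `M_22` graphs. -/

theorem gewirtz_isDualTwoPoint : IsDualTwoPoint 20 (1 / 15) (p := 1)
    ![-16 / 35, 1 / 15, 1] ![4802 / 451, 26163 / 451, 1] := by
  -- The first two constants are rational upper bounds for `√(E_4(x) / (1 - x^2))` at the nodes
  -- `-16/35` and `1/15`, where `E_4` is the energy in degree `4`; they leave the weighted sum below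
  -- `1`.
  refine isDualTwoPoint_three (93 / 10000) (33 / 5000) 4 ?_ ?_ ?_ ?_ ?_ ?_ ?_ ?_ ?_ ?_ ?_ fun k hk => ?_
  on_goal 12 => interval_cases k
  all_goals norm_num [gegenbauerEnergy, normGegenbauer]

theorem gewirtz_feasible : IsTwoPointFeasible 20 (1 / 15)
    (primalPolynomial (p := 1) ![-16 / 35, 1 / 15, 1]) 3
    -- These are the Gegenbauer coefficients of the cubic `(x + 16/35)^2 (x - 1/15)`. The default
    -- `0` is never reached for `k ≤ 3`.
    (fun k => [697 / 24500, 22993 / 1455300, 89 / 18900, 1 / 1320].getD k 0) where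
  nonpos _ _ hx := primalPolynomial_nonpos _ hx
  expansion := by
    refine Polynomial.funext fun x => ?_
    rw [eval_primalPolynomial_three]
    simp [Finset.sum_range_succ, gegenbauer]
    ring
  coeff_nonneg k hk := by interval_cases k <;> norm_num
  coeff_zero_pos := by norm_num

theorem hoffmanSingleton_isDualTwoPoint : IsDualTwoPoint 21 (1 / 21) (p := 1)
    ![-11 / 21, 1 / 21, 1] ![7, 56, 1] := by
  refine isDualTwoPoint_three (13 / 500) (4 / 625) 4 ?_ ?_ ?_ ?_ ?_ ?_ ?_ ?_ ?_ ?_ ?_ fun k hk => ?_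
  on_goal 12 => interval_cases k
  all_goals norm_num [gegenbauerEnergy, normGegenbauer]

theorem hoffmanSingleton_feasible : IsTwoPointFeasible 21 (1 / 21)
    (primalPolynomial (p := 1) ![-11 / 21, 1 / 21, 1]) 3
    (fun k => [320 / 9261, 400 / 21413, 2 / 399, 2 / 3059].getD k 0) where
  nonpos _ _ hx := primalPolynomial_nonpos _ hx
  expansion := by
    refine Polynomial.funext fun x => ?_
    rw [eval_primalPolynomial_three]
    simp [Finset.sum_range_succ, gegenbauer]
    ring
  coeff_nonneg k hk := by interval_cases k <;> norm_num
  coeff_zero_pos := by norm_num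

theorem mTwentyTwo_isDualTwoPoint : IsDualTwoPoint 21 (1 / 12) (p := 1)
    ![-13 / 33, 1 / 12, 1] ![14641 / 861, 58880 / 861, 1] := by
  refine isDualTwoPoint_three (11 / 1000) (53 / 10000) 4 ?_ ?_ ?_ ?_ ?_ ?_ ?_ ?_ ?_ ?_ ?_ fun k hk => ?_
  on_goal 12 => interval_cases k
  all_goals norm_num [gegenbauerEnergy, normGegenbauer]

theorem mTwentyTwo_feasible : IsTwoPointFeasible 21 (1 / 12)
    (primalPolynomial (p := 1) ![-13 / 33, 1 / 12, 1]) 3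
    (fun k => [943 / 45738, 3673 / 317262, 31 / 8778, 2 / 3059].getD k 0) where
  nonpos _ _ hx := primalPolynomial_nonpos _ hx
  expansion := by
    refine Polynomial.funext fun x => ?_
    rw [eval_primalPolynomial_three]
    simp [Finset.sum_range_succ, gegenbauer]
    ring
  coeff_nonneg k hk := by interval_cases k <;> norm_num
  coeff_zero_pos := by norm_num

/-! ### Four-node certificates: the Nordstrom-Robinson and Kerdock codes. -/

theorem nordstromRobinson_isDualTwoPoint : IsDualTwoPoint 16 (1 / 4) (p := 2)
    ![-1 / 2 - √3 / 6, -1 / 2 + √3 / 6, 1 / 4, 1]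
    ![3825 / 46 - 2115 / 46 * √3, 3825 / 46 + 2115 / 46 * √3, 3328 / 23, 1] := by
  have hs : √3 ^ 2 = (3 : ℝ) := Real.sq_sqrt (by norm_num)
  have hlo : 1732050807568877293527446341505 / 10 ^ 30 < √3 := Real.lt_sqrt_of_sq_lt (by norm_num)
  have hhi : √3 < 1732050807568877293527446341506 / 10 ^ 30 := (Real.sqrt_lt' (by norm_num)).2 (by norm_num)
  -- The values are tabulated so that each degree needs only the two before it. The table ends at
  -- degree `8` because the energy in degree `7` involves degrees `7` and `8`.
  have p2 : normGegenbauerPair ((16 : ℕ) / 2 - 1) (-1 / 2) (1 / 6) 3 2 =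
      (13 / 45, -8 / 45) := by
    norm_num [normGegenbauerPair]
  have p3 : normGegenbauerPair ((16 : ℕ) / 2 - 1) (-1 / 2) (1 / 6) 3 3 =
      (-1 / 5, 2 / 15) := by
    norm_num [normGegenbauerPair, p2]
  have p4 : normGegenbauerPair ((16 : ℕ) / 2 - 1) (-1 / 2) (1 / 6) 3 4 =
      (37 / 255, -22 / 255) := by
    norm_num [normGegenbauerPair, p3, p2]
  have p5 : normGegenbauerPair ((16 : ℕ) / 2 - 1) (-1 / 2) (1 / 6) 3 5 =
      (-89 / 918, 145 / 2754) := by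
    norm_num [normGegenbauerPair, p4, p3]
  have p6 : normGegenbauerPair ((16 : ℕ) / 2 - 1) (-1 / 2) (1 / 6) 3 6 =
      (491 / 8721, -10 / 323) := by
    norm_num [normGegenbauerPair, p5, p4]
  have p7 : normGegenbauerPair ((16 : ℕ) / 2 - 1) (-1 / 2) (1 / 6) 3 7 =
      (-241 / 8721, 2162 / 130815) := by
    norm_num [normGegenbauerPair, p6, p5]
  have p8 : normGegenbauerPair ((16 : ℕ) / 2 - 1) (-1 / 2) (1 / 6) 3 8 =
      (4189 / 392445, -2684 / 392445) := by
    norm_num [normGegenbauerPair, p7, p6]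
  rw [show √3 / 6 = 1 / 6 * √3 by ring]
  refine isDualTwoPoint_four (867 / 10000) (19 / 10000) (9 / 5000) 7 (by norm_num) hs
    ?_ ?_ ?_ ?_ ?_ ?_ ?_ ?_ ?_ ?_ ?_ ?_ ?_ ?_ fun k hk => ?_
  on_goal 11 =>
    -- The lower node is the upper one with `-√3` for `√3`, so the same pairs apply.
    rw [show -1 / 2 - 1 / 6 * √3 = -1 / 2 + 1 / 6 * -√3 by ring]
    refine energy_le_of_pair ((neg_sq _).trans hs) _ _ p7 p8 ?_
    norm_num [energyRat, energyIrr]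
  on_goal 12 =>
    refine energy_le_of_pair hs _ _ p7 p8 ?_
    norm_num [energyRat, energyIrr]
  on_goal 15 =>
    interval_cases k
    all_goals norm_num [normGegenbauerPair, normGegenbauer, p2, p3, p4, p5, p6, p7]
  on_goal 13 => norm_num [gegenbauerEnergy, normGegenbauer]
  -- The remaining goals are linear in `√3` and follow from `hlo` and `hhi`.
  all_goals linarith

/-- The conjugate nodes are the roots of a rational quadratic, so the primal polynomial and its
Gegenbauer coefficients are rational. -/
theorem nordstromRobinson_eval_primalPolynomial (x : ℝ) :
    (primalPolynomial (p := 2) ![-1 / 2 - √3 / 6, -1 / 2 + √3 / 6, 1 / 4, 1]).eval x =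
      (x ^ 2 + x + 1 / 6) ^ 2 * (x - 1 / 4) := by
  have hs : √3 ^ 2 = (3 : ℝ) := Real.sq_sqrt (by norm_num)
  have hq : (x - (-1 / 2 - √3 / 6)) * (x - (-1 / 2 + √3 / 6)) = x ^ 2 + x + 1 / 6 := by
    linear_combination (-1 / 6 ^ 2) * hs
  rw [← hq]
  simp [primalPolynomial, Fin.prod_univ_two, mul_pow]

theorem nordstromRobinson_feasible : IsTwoPointFeasible 16 (1 / 4)
    (primalPolynomial (p := 2) ![-1 / 2 - √3 / 6, -1 / 2 + √3 / 6, 1 / 4, 1]) 5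
    (fun k => [13 / 1152, 1 / 112, 3 / 640, 85 / 44352, 1 / 1920, 1 / 14784].getD k 0) where
  nonpos _ _ hx := primalPolynomial_nonpos _ hx
  expansion := by
    refine Polynomial.funext fun x => ?_
    rw [nordstromRobinson_eval_primalPolynomial]
    simp [Finset.sum_range_succ, gegenbauer]
    ring
  coeff_nonneg k hk := by interval_cases k <;> norm_num
  coeff_zero_pos := by norm_num

theorem kerdockSixtyFour_isDualTwoPoint : IsDualTwoPoint 64 (1 / 8) (p := 2)
    ![-1 / 2 - √627 / 66, -1 / 2 + √627 / 66, 1 / 8, 1]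
    ![1178199 / 1042 - 892485 / 19798 * √627, 1178199 / 1042 + 892485 / 19798 * √627, 1138688 / 521, 1] := by
  have hs : √627 ^ 2 = (627 : ℝ) := Real.sq_sqrt (by norm_num)
  have hlo : 25039968051097828826878131177704 / 10 ^ 30 < √627 := Real.lt_sqrt_of_sq_lt (by norm_num)
  have hhi : √627 < 25039968051097828826878131177705 / 10 ^ 30 := (Real.sqrt_lt' (by norm_num)).2 (by norm_num)
  have p2 : normGegenbauerPair ((64 : ℕ) / 2 - 1) (-1 / 2) (1 / 66) 627 2 =
      (799 / 2079, -32 / 2079) := by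
    norm_num [normGegenbauerPair]
  have p3 : normGegenbauerPair ((64 : ℕ) / 2 - 1) (-1 / 2) (1 / 66) 627 3 =
      (-1 / 3, 4 / 297) := by
    norm_num [normGegenbauerPair, p2]
  have p4 : normGegenbauerPair ((64 : ℕ) / 2 - 1) (-1 / 2) (1 / 66) 627 4 =
      (39253 / 135135, -314 / 27027) := by
    norm_num [normGegenbauerPair, p3, p2]
  have p5 : normGegenbauerPair ((64 : ℕ) / 2 - 1) (-1 / 2) (1 / 66) 627 5 =
      (-63935 / 254826, 84199 / 8409258) := by
    norm_num [normGegenbauerPair, p4, p3]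
  have p6 : normGegenbauerPair ((64 : ℕ) / 2 - 1) (-1 / 2) (1 / 66) 627 6 =
      (47185291 / 219107889, -28118 / 3270267) := by
    norm_num [normGegenbauerPair, p5, p4]
  have p7 : normGegenbauerPair ((64 : ℕ) / 2 - 1) (-1 / 2) (1 / 66) 627 7 =
      (-5757145 / 31301127, 7587652 / 1032937191) := by
    norm_num [normGegenbauerPair, p6, p5]
  have p8 : normGegenbauerPair ((64 : ℕ) / 2 - 1) (-1 / 2) (1 / 66) 627 8 =
      (11140629971 / 71272666179, -444933388 / 71272666179) := by
    norm_num [normGegenbauerPair, p7, p6]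
  rw [show √627 / 66 = 1 / 66 * √627 by ring]
  refine isDualTwoPoint_four (79 / 200) (33 / 1000000) (1 / 31250) 7 (by norm_num) hs
    ?_ ?_ ?_ ?_ ?_ ?_ ?_ ?_ ?_ ?_ ?_ ?_ ?_ ?_ fun k hk => ?_
  on_goal 11 =>
    rw [show -1 / 2 - 1 / 66 * √627 = -1 / 2 + 1 / 66 * -√627 by ring]
    refine energy_le_of_pair ((neg_sq _).trans hs) _ _ p7 p8 ?_
    norm_num [energyRat, energyIrr]
  on_goal 12 =>
    refine energy_le_of_pair hs _ _ p7 p8 ?_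
    norm_num [energyRat, energyIrr]
  on_goal 15 =>
    interval_cases k
    all_goals norm_num [normGegenbauerPair, normGegenbauer, p2, p3, p4, p5, p6, p7]
  on_goal 13 => norm_num [gegenbauerEnergy, normGegenbauer]
  all_goals linarith

theorem kerdockSixtyFour_eval_primalPolynomial (x : ℝ) :
    (primalPolynomial (p := 2) ![-1 / 2 - √627 / 66, -1 / 2 + √627 / 66, 1 / 8, 1]).eval x =
      (x ^ 2 + x + 7 / 66) ^ 2 * (x - 1 / 8) := by
  have hs : √627 ^ 2 = (627 : ℝ) := Real.sq_sqrt (by norm_num)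
  have hq : (x - (-1 / 2 - √627 / 66)) * (x - (-1 / 2 + √627 / 66)) = x ^ 2 + x + 7 / 66 := by
    linear_combination (-1 / 66 ^ 2) * hs
  rw [← hq]
  simp [primalPolynomial, Fin.prod_univ_two, mul_pow]

theorem kerdockSixtyFour_feasible : IsTwoPointFeasible 64 (1 / 8)
    (primalPolynomial (p := 2) ![-1 / 2 - √627 / 66, -1 / 2 + √627 / 66, 1 / 8, 1]) 5
    (fun k => [973 / 1115136, 4711 / 9182448, 2029 / 17808384, 1021 / 40330752, 15 / 5936128, 1 / 10388224].getD k 0) where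
  nonpos _ _ hx := primalPolynomial_nonpos _ hx
  expansion := by
    refine Polynomial.funext fun x => ?_
    rw [kerdockSixtyFour_eval_primalPolynomial]
    simp [Finset.sum_range_succ, gegenbauer]
    ring
  coeff_nonneg k hk := by interval_cases k <;> norm_num
  coeff_zero_pos := by norm_num

theorem kerdockTwoFiftySix_isDualTwoPoint : IsDualTwoPoint 256 (1 / 16) (p := 2)
    ![-1 / 2 - √1419 / 86, -1 / 2 + √1419 / 86, 1 / 16, 1]
    ![15594423 / 914 - 4553399 / 10054 * √1419, 15594423 / 914 + 4553399 / 10054 * √1419, 15466496 / 457, 1] := by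
  have hs : √1419 ^ 2 = (1419 : ℝ) := Real.sq_sqrt (by norm_num)
  have hlo : 37669616403674726031806583363444 / 10 ^ 30 < √1419 := Real.lt_sqrt_of_sq_lt (by norm_num)
  have hhi : √1419 < 37669616403674726031806583363445 / 10 ^ 30 := (Real.sqrt_lt' (by norm_num)).2 (by norm_num)
  have p2 : normGegenbauerPair ((256 : ℕ) / 2 - 1) (-1 / 2) (1 / 86) 1419 2 =
      (1607 / 3655, -128 / 10965) := by
    norm_num [normGegenbauerPair]
  have p3 : normGegenbauerPair ((256 : ℕ) / 2 - 1) (-1 / 2) (1 / 86) 1419 3 =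
      (-7 / 17, 8 / 731) := by
    norm_num [normGegenbauerPair, p2]
  have p4 : normGegenbauerPair ((256 : ℕ) / 2 - 1) (-1 / 2) (1 / 86) 1419 4 =
      (362429 / 939335, -566 / 55255) := by
    norm_num [normGegenbauerPair, p3, p2]
  have p5 : normGegenbauerPair ((256 : ℕ) / 2 - 1) (-1 / 2) (1 / 86) 1419 5 =
      (-343243 / 950386, 19982153 / 2084196498) := by
    norm_num [normGegenbauerPair, p4, p3]
  have p6 : normGegenbauerPair ((256 : ℕ) / 2 - 1) (-1 / 2) (1 / 86) 1419 6 =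
      (30397013635 / 89967815497, -806934934 / 89967815497) := by
    norm_num [normGegenbauerPair, p5, p4]
  have p7 : normGegenbauerPair ((256 : ℕ) / 2 - 1) (-1 / 2) (1 / 86) 1419 7 =
      (-4060155317 / 12852545071, 4634682672 / 552659438053) := by
    norm_num [normGegenbauerPair, p6, p5]
  have p8 : normGegenbauerPair ((256 : ℕ) / 2 - 1) (-1 / 2) (1 / 86) 1419 8 =
      (4731345569537 / 16027123703537, -376803362788 / 48081371110611) := by
    norm_num [normGegenbauerPair, p7, p6]
  rw [show √1419 / 86 = 1 / 86 * √1419 by ring]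
  refine isDualTwoPoint_four (13 / 20) (81 / 100000000) (81 / 100000000) 7 (by norm_num) hs
    ?_ ?_ ?_ ?_ ?_ ?_ ?_ ?_ ?_ ?_ ?_ ?_ ?_ ?_ fun k hk => ?_
  on_goal 11 =>
    rw [show -1 / 2 - 1 / 86 * √1419 = -1 / 2 + 1 / 86 * -√1419 by ring]
    refine energy_le_of_pair ((neg_sq _).trans hs) _ _ p7 p8 ?_
    norm_num [energyRat, energyIrr]
  on_goal 12 =>
    refine energy_le_of_pair hs _ _ p7 p8 ?_
    norm_num [energyRat, energyIrr]
  on_goal 15 =>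
    interval_cases k
    all_goals norm_num [normGegenbauerPair, normGegenbauer, p2, p3, p4, p5, p6, p7]
  on_goal 13 => norm_num [gegenbauerEnergy, normGegenbauer]
  all_goals linarith

theorem kerdockTwoFiftySix_eval_primalPolynomial (x : ℝ) :
    (primalPolynomial (p := 2) ![-1 / 2 - √1419 / 86, -1 / 2 + √1419 / 86, 1 / 16, 1]).eval x =
      (x ^ 2 + x + 5 / 86) ^ 2 * (x - 1 / 16) := by
  have hs : √1419 ^ 2 = (1419 : ℝ) := Real.sq_sqrt (by norm_num)
  have hq : (x - (-1 / 2 - √1419 / 86)) * (x - (-1 / 2 + √1419 / 86)) = x ^ 2 + x + 5 / 86 := by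
    linear_combination (-1 / 86 ^ 2) * hs
  rw [← hq]
  simp [primalPolynomial, Fin.prod_univ_two, mul_pow]

theorem kerdockTwoFiftySix_feasible : IsTwoPointFeasible 256 (1 / 16)
    (primalPolynomial (p := 2) ![-1 / 2 - √1419 / 86, -1 / 2 + √1419 / 86, 1 / 16, 1]) 5
    (fun k => [885 / 15147008, 189 / 6105398, 8159 / 2907873280, 46391 / 126000386048, 31 / 2907873280, 1 / 9523284992].getD k 0) where
  nonpos _ _ hx := primalPolynomial_nonpos _ hx
  expansion := by
    refine Polynomial.funext fun x => ?_
    rw [kerdockTwoFiftySix_eval_primalPolynomial]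
    simp [Finset.sum_range_succ, gegenbauer]
    ring
  coeff_nonneg k hk := by interval_cases k <;> norm_num
  coeff_zero_pos := by norm_num

theorem kerdockTenTwentyFour_isDualTwoPoint : IsDualTwoPoint 1024 (1 / 32) (p := 2)
    ![-1 / 2 - √231363 / 1026, -1 / 2 + √231363 / 1026, 1 / 32, 1]
    ![17508632031 / 65602 - 1492406775 / 2689682 * √231363, 17508632031 / 65602 + 1492406775 / 2689682 * √231363, 17473470464 / 32801, 1] := by
  have hs : √231363 ^ 2 = (231363 : ℝ) := Real.sq_sqrt (by norm_num)
  -- Many digits are needed. At the upper conjugate node the rational part of the energy, about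
  -- `0.02`, cancels against the irrational part to below `10^(-15)`.
  have hlo : 481002078997586038500255809486717 / 10 ^ 30 < √231363 := Real.lt_sqrt_of_sq_lt (by norm_num)
  have hhi : √231363 < 481002078997586038500255809486718 / 10 ^ 30 := (Real.sqrt_lt' (by norm_num)).2 (by norm_num)
  have p2 : normGegenbauerPair ((1024 : ℕ) / 2 - 1) (-1 / 2) (1 / 1026) 231363 2 =
      (246271 / 524799, -512 / 524799) := by
    norm_num [normGegenbauerPair]
  have p3 : normGegenbauerPair ((1024 : ℕ) / 2 - 1) (-1 / 2) (1 / 1026) 231363 3 =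
      (-5 / 11, 16 / 16929) := by
    norm_num [normGegenbauerPair, p2]
  have p4 : normGegenbauerPair ((1024 : ℕ) / 2 - 1) (-1 / 2) (1 / 1026) 231363 4 =
      (236853061 / 537918975, -492418 / 537918975) := by
    norm_num [normGegenbauerPair, p3, p2]
  have p5 : normGegenbauerPair ((1024 : ℕ) / 2 - 1) (-1 / 2) (1 / 1026) 231363 5 =
      (-1518533927 / 3560676570, 323910275 / 365325416082) := by
    norm_num [normGegenbauerPair, p4, p3]
  have p6 : normGegenbauerPair ((1024 : ℕ) / 2 - 1) (-1 / 2) (1 / 1026) 231363 6 =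
      (4003351121016113 / 9692387726502195, -2774313010306 / 3230795908834065) := by
    norm_num [normGegenbauerPair, p5, p4]
  have p7 : normGegenbauerPair ((1024 : ℕ) / 2 - 1) (-1 / 2) (1 / 1026) 231363 7 =
      (-25012965858731 / 62531533719369, 10260351865336 / 12337952614629345) := by
    norm_num [normGegenbauerPair, p6, p5]
  have p8 : normGegenbauerPair ((1024 : ℕ) / 2 - 1) (-1 / 2) (1 / 1026) 231363 8 =
      (40446314803555290719 / 104416092977608146735, -588613264004833828 / 730912650843257027145) := by
    norm_num [normGegenbauerPair, p7, p6]
  rw [show √231363 / 1026 = 1 / 1026 * √231363 by ring]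
  refine isDualTwoPoint_four (811 / 1000) (3 / 125000000) (3 / 125000000) 7 (by norm_num) hs
    ?_ ?_ ?_ ?_ ?_ ?_ ?_ ?_ ?_ ?_ ?_ ?_ ?_ ?_ fun k hk => ?_
  on_goal 11 =>
    rw [show -1 / 2 - 1 / 1026 * √231363 = -1 / 2 + 1 / 1026 * -√231363 by ring]
    refine energy_le_of_pair ((neg_sq _).trans hs) _ _ p7 p8 ?_
    norm_num [energyRat, energyIrr]
  on_goal 12 =>
    refine energy_le_of_pair hs _ _ p7 p8 ?_
    norm_num [energyRat, energyIrr]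
  on_goal 15 =>
    interval_cases k
    all_goals norm_num [normGegenbauerPair, normGegenbauer, p2, p3, p4, p5, p6, p7]
  on_goal 13 => norm_num [gegenbauerEnergy, normGegenbauer]
  all_goals linarith

theorem kerdockTenTwentyFour_eval_primalPolynomial (x : ℝ) :
    (primalPolynomial (p := 2) ![-1 / 2 - √231363 / 1026, -1 / 2 + √231363 / 1026, 1 / 32, 1]).eval x =
      (x ^ 2 + x + 31 / 1026) ^ 2 * (x - 1 / 32) := by
  have hs : √231363 ^ 2 = (231363 : ℝ) := Real.sq_sqrt (by norm_num)
  have hq : (x - (-1 / 2 - √231363 / 1026)) * (x - (-1 / 2 + √231363 / 1026)) = x ^ 2 + x + 31 / 1026 := by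
    linear_combination (-1 / 1026 ^ 2) * hs
  rw [← hq]
  simp [primalPolynomial, Fin.prod_univ_two, mul_pow]

theorem kerdockTenTwentyFour_feasible : IsTwoPointFeasible 1024 (1 / 32)
    (primalPolynomial (p := 2) ![-1 / 2 - √231363 / 1026, -1 / 2 + √231363 / 1026, 1 / 32, 1]) 5
    (fun k => [64573 / 17247043584, 2117393 / 1105958248416, 46747 / 630744219648, 851881 / 151293940826112, 1 / 23360897024, 1 / 9474303799296].getD k 0) where
  nonpos _ _ hx := primalPolynomial_nonpos _ hx
  expansion := by
    refine Polynomial.funext fun x => ?_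
    rw [kerdockTenTwentyFour_eval_primalPolynomial]
    simp [Finset.sum_range_succ, gegenbauer]
    ring
  coeff_nonneg k hk := by interval_cases k <;> norm_num
  coeff_zero_pos := by norm_num

/-! ### Assembly of the table. -/

theorem TwoPointCase.isValid_of_mem : ∀ r ∈ twoPointTable, r.IsValid := by
  simp only [twoPointTable, List.forall_mem_cons, List.not_mem_nil, false_imp_iff, implies_true,
    and_true]
  refine ⟨⟨?_, ⟨5, _, nordstromRobinson_feasible, ?_⟩, nordstromRobinson_isDualTwoPoint, ?_⟩,
    ⟨?_, ⟨3, _, gewirtz_feasible, ?_⟩, gewirtz_isDualTwoPoint, ?_⟩,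
    ⟨?_, ⟨3, _, hoffmanSingleton_feasible, ?_⟩, hoffmanSingleton_isDualTwoPoint, ?_⟩,
    ⟨?_, ⟨3, _, mTwentyTwo_feasible, ?_⟩, mTwentyTwo_isDualTwoPoint, ?_⟩,
    ⟨?_, ⟨5, _, kerdockSixtyFour_feasible, ?_⟩, kerdockSixtyFour_isDualTwoPoint, ?_⟩,
    ⟨?_, ⟨5, _, kerdockTwoFiftySix_feasible, ?_⟩, kerdockTwoFiftySix_isDualTwoPoint, ?_⟩,
    ⟨?_, ⟨5, _, kerdockTenTwentyFour_feasible, ?_⟩, kerdockTenTwentyFour_isDualTwoPoint, ?_⟩⟩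
  · norm_num
  · rw [nordstromRobinson_eval_primalPolynomial]; norm_num
  · simp [Fin.sum_univ_succ]; ring
  · norm_num
  · rw [eval_primalPolynomial_three]; norm_num
  · norm_num [Fin.sum_univ_succ]
  · norm_num
  · rw [eval_primalPolynomial_three]; norm_num
  · norm_num [Fin.sum_univ_succ]
  · norm_num
  · rw [eval_primalPolynomial_three]; norm_num
  · norm_num [Fin.sum_univ_succ]
  · norm_num
  · rw [kerdockSixtyFour_eval_primalPolynomial]; norm_num
  · simp [Fin.sum_univ_succ]; ring
  · norm_num
  · rw [kerdockTwoFiftySix_eval_primalPolynomial]; norm_num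
  · simp [Fin.sum_univ_succ]; ring
  · norm_num
  · rw [kerdockTenTwentyFour_eval_primalPolynomial]; norm_num
  · simp [Fin.sum_univ_succ]; ring

theorem mainTheorem9 : ∀ r ∈ twoPointTable,
    -- the exact value of the two-point bound
    IsTwoPointBound r.n r.cosine r.bound ∧
    -- it is not sharp
    (r.N : ℝ) < r.bound ∧
    (∀ C : Finset (EuclideanSpace ℝ (Fin r.n)), C.card = r.N → IsSphericalCode C r.cosine →
      ¬ IsTwoPointSharp C) ∧
    -- matching primal polynomial and dual weights
    (∃ (d : ℕ) (a : ℕ → ℝ),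
      IsTwoPointFeasible r.n r.cosine (primalPolynomial r.t) d a ∧
      (primalPolynomial r.t).eval 1 / a 0 = r.bound) ∧
    IsDualTwoPoint r.n r.cosine r.t r.w ∧
    ∑ j, r.w j = r.bound := by
  intro r hr
  obtain ⟨hlt, hf, hdual, hsum⟩ := TwoPointCase.isValid_of_mem r hr
  have hb : IsTwoPointBound r.n r.cosine r.bound :=
    isTwoPointBound_of_certificates hdual hsum ⟨_, hf⟩
  exact ⟨hb, hlt, fun C hC hcode => hb.not_sharp hcode (hC ▸ hlt), hf, hdual, hsum⟩
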